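/- Let $\mathscr V$ be a cocomplete symmetric monoidal closed category. Let $\mathscr V\text{-}\mathrm{Mod}$ be the bicategory whose objects are small $\mathscr V$-categories, whose 1-morphisms $M:\mathscr A\to\mathscr B$ are two-sided modules (families $M(B,A)\in\mathscr V$, contravariant in $B$ and covariant in $A$, i.e. $\mathscr V$-functors $\mathscr B^{\mathrm{op}}\otimes\mathscr A\to\mathscr V$), whose 2-morphisms are module morphisms, and whose composition is $(N\circ M)(C,A)=\int^{B}M(B,A)\otimes N(C,B)$. A $\mathscr V$-functor $F:\mathscr A\to\mathscr B$ gives modules $F_*(B,A)=\mathscr B(B,FA)$ and $F^*(A,B)=\mathscr B(FA,B)$ with $F_*\dashv F^*$. For a module $M:\mathscr A\to\mathscr U$, the collage $\mathrm C(M)$ is the $\mathscr V$-category containing $\mathscr A$ and $\mathscr U$ as disjoint full sub-$\mathscr V$-categories, with inclusions $i_1:\mathscr A\to\mathrm C(M)$ and $i_0:\mathscr U\to\mathrm C(M)$, with no other objects, with $\mathrm C(M)(i_0U,i_1A)=M(U,A)$ and $\mathrm C(M)(i_1A,i_0U)=0$ (the initial object), and with composition given by the compositions of $\mathscr A$ and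 $\mathscr U$ and their actions on $M$. It carries a 2-morphism $\nu:i_{0*}\circ M\Rightarrow i_{1*}$ of $\mathscr V\text{-}\mathrm{Mod}$, given by composition $\mathrm C(M)(X,i_0U)\otimes M(U,A)\to\mathrm C(M)(X,i_1A)$. Let $\mathscr A\xleftarrow{\,Q\,}\mathscr S\xrightarrow{\,P\,}\mathscr U$ be a span of $\mathscr V$-functors between small $\mathscr V$-categories. Its cocomma square is the square with sides $Q$, $P$, $i_0:\mathscr U\to\mathrm C(P_*\circ Q^*)$ and $i_1:\mathscr A\to\mathrm C(P_*\circ Q^*)$, and with the 2-morphism $\lambda: i_{0*}\circ P_*\Rightarrow i_{1*}\circ Q_*$ that is the mate under $Q_*\dashv Q^*$ of the collage 2-morphism $\nu:i_{0*}\circ P_*\circ Q^*\Rightarrow i_{1*}$. **Proposition.** The cocomma square of every such span is BC (exact): the mate $$\overline\lambda:\;P_*\circ Q^*\Longrightarrow i_0^*\circ i_{1*}$$ of $\lambda$ under the adjunctions $Q_*\dashv Q^*$ and $i_{0*}\dashv i_0^*$ is invertible in $\mathscr V\text{-}\mathrm{Mod}$. In particular $i_0^*\circ i_{1*}\cong P_*\circ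 Q^*$. -/

import Mathlib

set_option linter.unusedSectionVars false
set_option linter.unusedSimpArgs false

open CategoryTheory MonoidalCategory Limits

universe w v u

namespace EnrichedModules

/-- A `V`-category with object set in `Type w`, regarded as an object of the bicategory `V`-Mod. -/
structure VMod (V : Type u) [Category.{v} V] [MonoidalCategory V] where
  carrier : Type w
  [enr : EnrichedCategory V carrier]

attribute [instance] VMod.enr

/-- A two-sided module (profunctor) `M : A ⟶ B`: objects `M.obj b a` of `V`, contravariant in `b`
and covariant in `a`, with a unital associative left action of `B` and right action of `A` that
commute with each other (that is, a `V`-functor `Bᵒᵖ ⊗ A ⟶ V`). -/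
structure Mdl {V : Type u} [Category.{v} V] [MonoidalCategory V] (A B : VMod.{w} V) where
  obj : B.carrier → A.carrier → V
  lact : ∀ (b b' : B.carrier) (a : A.carrier), (b ⟶[V] b') ⊗ obj b' a ⟶ obj b a
  ract : ∀ (b : B.carrier) (a a' : A.carrier), obj b a ⊗ (a ⟶[V] a') ⟶ obj b a'
  id_lact : ∀ b a, eId V b ▷ obj b a ≫ lact b b a = (λ_ _).hom
  comp_lact : ∀ b b' b'' a, eComp V b b' b'' ▷ obj b'' a ≫ lact b b'' a =
    (α_ _ _ _).hom ≫ (b ⟶[V] b') ◁ lact b' b'' a ≫ lact b b' a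
  ract_id : ∀ b a, obj b a ◁ eId V a ≫ ract b a a = (ρ_ _).hom
  ract_comp : ∀ b a a' a'', obj b a ◁ eComp V a a' a'' ≫ ract b a a'' =
    (α_ _ _ _).inv ≫ ract b a a' ▷ (a' ⟶[V] a'') ≫ ract b a' a''
  lact_ract : ∀ b b' a a', lact b b' a ▷ (a ⟶[V] a') ≫ ract b a a' =
    (α_ _ _ _).hom ≫ (b ⟶[V] b') ◁ ract b' a a' ≫ lact b b' a'

section Basic

variable {V : Type u} [Category.{v} V] [MonoidalCategory V]

/-- A morphism of modules: a family of morphisms compatible with both actions. -/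
@[ext]
structure MdlHom {A B : VMod.{w} V} (M N : Mdl A B) where
  app : ∀ b a, M.obj b a ⟶ N.obj b a
  lact_app : ∀ b b' a, M.lact b b' a ≫ app b a = (b ⟶[V] b') ◁ app b' a ≫ N.lact b b' a
  ract_app : ∀ b a a', M.ract b a a' ≫ app b a' = app b a ▷ (a ⟶[V] a') ≫ N.ract b a a'

instance (A B : VMod.{w} V) : Category (Mdl A B) where
  Hom M N := MdlHom M N
  id M := { app := fun _ _ => 𝟙 _, lact_app := by simp, ract_app := by simp }
  comp f g :=
    { app := fun b a => f.app b a ≫ g.app b a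
      lact_app := by intros; simp [reassoc_of% MdlHom.lact_app, MdlHom.lact_app]
      ract_app := by intros; simp [reassoc_of% MdlHom.ract_app, MdlHom.ract_app] }

@[ext]
theorem Mdl.hom_ext {A B : VMod.{w} V} {M N : Mdl A B} {f g : M ⟶ N}
    (h : ∀ b a, MdlHom.app f b a = MdlHom.app g b a) : f = g :=
  MdlHom.ext (by funext b a; exact h b a)

@[simp]
theorem Mdl.id_app {A B : VMod.{w} V} (M : Mdl A B) (b : B.carrier) (a : A.carrier) :
    MdlHom.app (𝟙 M) b a = 𝟙 _ := rfl

@[simp]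
theorem Mdl.comp_app {A B : VMod.{w} V} {M N K : Mdl A B} (f : M ⟶ N) (g : N ⟶ K)
    (b : B.carrier) (a : A.carrier) :
    MdlHom.app (f ≫ g) b a = MdlHom.app f b a ≫ MdlHom.app g b a := rfl

/-- An isomorphism of modules from a family of isomorphisms. -/
@[simps]
def Mdl.isoMk {A B : VMod.{w} V} {M N : Mdl A B} (f : M ⟶ N)
    (g : ∀ b a, N.obj b a ⟶ M.obj b a) (h₁ : ∀ b a, MdlHom.app f b a ≫ g b a = 𝟙 _)
    (h₂ : ∀ b a, g b a ≫ MdlHom.app f b a = 𝟙 _) : M ≅ N where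
  hom := f
  inv :=
    { app := g
      lact_app := fun b b' a => by
        have := congrArg (fun t => (b ⟶[V] b') ◁ g b' a ≫ t ≫ g b a) (MdlHom.lact_app f b b' a)
        simp only [Category.assoc, h₁, Category.comp_id] at this
        rw [this, ← whiskerLeft_comp_assoc, h₂]; simp
      ract_app := fun b a a' => by
        have := congrArg (fun t => g b a ▷ (a ⟶[V] a') ≫ t ≫ g b a') (MdlHom.ract_app f b a a')
        simp only [Category.assoc, h₁, Category.comp_id] at this
        rw [this, ← comp_whiskerRight_assoc, h₂]; simp }
  hom_inv_id := by ext b a; exact h₁ b a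
  inv_hom_id := by ext b a; exact h₂ b a

/-- The identity module `A(a', a)`. -/
abbrev idMdl (A : VMod.{w} V) : Mdl A A where
  obj a' a := a' ⟶[V] a
  lact a a' a'' := eComp V a a' a''
  ract a a' a'' := eComp V a a' a''
  id_lact b a := by
    rw [← cancel_epi (λ_ _).inv]; simp
  comp_lact b b' b'' a := by
    rw [← cancel_epi (α_ _ _ _).inv]; simp
  ract_id b a := by
    rw [← cancel_epi (ρ_ _).inv]; simp
  ract_comp b a a' a'' := by simp
  lact_ract b b' a a' := by
    rw [← cancel_epi (α_ _ _ _).inv]; simp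

end Basic

section Comp

variable {V : Type u} [Category.{v} V] [MonoidalCategory V] [HasColimitsOfSize.{w, w} V]

/-- The diagram whose colimit is the coend `∫^b N(c, b) ⊗ M(b, a)`: the two maps from
`N(c, b) ⊗ B(b, b') ⊗ M(b', a)` given by the actions of `B` on `M` and on `N`. -/
@[simps]
def coendIndex {A B C : VMod.{w} V} (M : Mdl A B) (N : Mdl B C)
    (c : C.carrier) (a : A.carrier) : MultispanIndex (MultispanShape.prod B.carrier) V where
  left p := N.obj c p.1 ⊗ ((p.1 ⟶[V] p.2) ⊗ M.obj p.2 a)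
  right b := N.obj c b ⊗ M.obj b a
  fst p := N.obj c p.1 ◁ M.lact p.1 p.2 a
  snd p := (α_ _ _ _).inv ≫ N.ract c p.1 p.2 ▷ M.obj p.2 a

/-- The coend `∫^b N(c, b) ⊗ M(b, a)`. -/
noncomputable def compObj {A B C : VMod.{w} V} (M : Mdl A B) (N : Mdl B C)
    (c : C.carrier) (a : A.carrier) : V :=
  multicoequalizer (coendIndex M N c a)

variable {A B C : VMod.{w} V} (M : Mdl A B) (N : Mdl B C) (c : C.carrier) (a : A.carrier)

/-- The coprojections of the coend. -/
noncomputable def compι (b : B.carrier) : N.obj c b ⊗ M.obj b a ⟶ compObj M N c a :=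
  Multicoequalizer.π (coendIndex M N c a) b

theorem compι_condition (b b' : B.carrier) :
    N.obj c b ◁ M.lact b b' a ≫ compι M N c a b =
      (α_ _ _ _).inv ≫ N.ract c b b' ▷ M.obj b' a ≫ compι M N c a b' := by
  exact (Multicoequalizer.condition (coendIndex M N c a) (b, b')).trans (Category.assoc _ _ _)

theorem compι_condition' (b b' : B.carrier) :
    N.ract c b b' ▷ M.obj b' a ≫ compι M N c a b' =
      (α_ _ _ _).hom ≫ N.obj c b ◁ M.lact b b' a ≫ compι M N c a b := by
  rw [compι_condition]; simp

variable {M N c a}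

@[ext]
theorem compObj_hom_ext {Y : V} {f g : compObj M N c a ⟶ Y}
    (h : ∀ b, compι M N c a b ≫ f = compι M N c a b ≫ g) : f = g :=
  Multicoequalizer.hom_ext _ _ _ h

/-- The morphism out of the coend induced by a dinatural family. -/
noncomputable def compDesc {Y : V} (f : ∀ b, N.obj c b ⊗ M.obj b a ⟶ Y)
    (h : ∀ b b', N.obj c b ◁ M.lact b b' a ≫ f b =
      (α_ _ _ _).inv ≫ N.ract c b b' ▷ M.obj b' a ≫ f b') : compObj M N c a ⟶ Y :=
  Multicoequalizer.desc (coendIndex M N c a) Y f 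
    (fun p => (h p.1 p.2).trans (Category.assoc _ _ _).symm)

@[simp]
theorem compι_desc {Y : V} (f : ∀ b, N.obj c b ⊗ M.obj b a ⟶ Y)
    (h : ∀ b b', N.obj c b ◁ M.lact b b' a ≫ f b =
      (α_ _ _ _).inv ≫ N.ract c b b' ▷ M.obj b' a ≫ f b') (b : B.carrier) :
    compι M N c a b ≫ compDesc f h = f b :=
  Multicoequalizer.π_desc _ _ _ _ _

variable [MonoidalClosed V]

theorem compObj_hom_ext_left {X Y : V} {f g : X ⊗ compObj M N c a ⟶ Y}
    (h : ∀ b, X ◁ compι M N c a b ≫ f = X ◁ compι M N c a b ≫ g) : f = g := by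
  apply MonoidalClosed.curry_injective
  ext b
  rw [← MonoidalClosed.curry_natural_left, ← MonoidalClosed.curry_natural_left, h]

/-- The morphism out of `X ⊗ ∫^b N(c, b) ⊗ M(b, a)` induced by a dinatural family. -/
noncomputable def descL {X Y : V} (f : ∀ b, X ⊗ (N.obj c b ⊗ M.obj b a) ⟶ Y)
    (h : ∀ b b', X ◁ N.obj c b ◁ M.lact b b' a ≫ f b =
      X ◁ (α_ _ _ _).inv ≫ X ◁ N.ract c b b' ▷ M.obj b' a ≫ f b') : X ⊗ compObj M N c a ⟶ Y :=
  MonoidalClosed.uncurry (compDesc (fun b => MonoidalClosed.curry (f b)) (by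
    intro b b'
    rw [← MonoidalClosed.curry_natural_left, ← MonoidalClosed.curry_natural_left,
      ← MonoidalClosed.curry_natural_left, h]))

@[simp]
theorem ι_descL {X Y : V} (f : ∀ b, X ⊗ (N.obj c b ⊗ M.obj b a) ⟶ Y)
    (h : ∀ b b', X ◁ N.obj c b ◁ M.lact b b' a ≫ f b =
      X ◁ (α_ _ _ _).inv ≫ X ◁ N.ract c b b' ▷ M.obj b' a ≫ f b') (b : B.carrier) :
    X ◁ compι M N c a b ≫ descL f h = f b := by
  rw [descL, ← MonoidalClosed.uncurry_natural_left]
  simp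

variable [SymmetricCategory V]

theorem compObj_hom_ext_right {X Y : V} {f g : compObj M N c a ⊗ X ⟶ Y}
    (h : ∀ b, compι M N c a b ▷ X ≫ f = compι M N c a b ▷ X ≫ g) : f = g := by
  rw [← cancel_epi (β_ X _).hom]
  apply compObj_hom_ext_left
  intro b
  rw [BraidedCategory.braiding_naturality_right_assoc, h,
    BraidedCategory.braiding_naturality_right_assoc]

/-- The morphism out of `(∫^b N(c, b) ⊗ M(b, a)) ⊗ X` induced by a dinatural family. -/
noncomputable def descR {X Y : V} (f : ∀ b, (N.obj c b ⊗ M.obj b a) ⊗ X ⟶ Y)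
    (h : ∀ b b', (N.obj c b ◁ M.lact b b' a) ▷ X ≫ f b =
      (α_ _ _ _).inv ▷ X ≫ N.ract c b b' ▷ M.obj b' a ▷ X ≫ f b') : compObj M N c a ⊗ X ⟶ Y :=
  (β_ _ _).hom ≫ descL (fun b => (β_ _ _).hom ≫ f b) (by
    intro b b'
    simp only [BraidedCategory.braiding_naturality_right_assoc, h])

@[simp]
theorem ι_descR {X Y : V} (f : ∀ b, (N.obj c b ⊗ M.obj b a) ⊗ X ⟶ Y)
    (h : ∀ b b', (N.obj c b ◁ M.lact b b' a) ▷ X ≫ f b =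
      (α_ _ _ _).inv ▷ X ≫ N.ract c b b' ▷ M.obj b' a ▷ X ≫ f b') (b : B.carrier) :
    compι M N c a b ▷ X ≫ descR f h = f b := by
  rw [descR, BraidedCategory.braiding_naturality_left_assoc, ι_descL]
  simp only [SymmetricCategory.symmetry_assoc]

theorem compObj_hom_ext_mid {X Y Z : V} {f g : (X ⊗ compObj M N c a) ⊗ Y ⟶ Z}
    (h : ∀ b, (X ◁ compι M N c a b) ▷ Y ≫ f = (X ◁ compι M N c a b) ▷ Y ≫ g) : f = g := by
  rw [← cancel_epi (α_ _ _ _).inv]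
  apply MonoidalClosed.curry_injective
  apply compObj_hom_ext_right
  intro b
  rw [← MonoidalClosed.curry_natural_left, ← MonoidalClosed.curry_natural_left,
    associator_inv_naturality_middle_assoc, associator_inv_naturality_middle_assoc, h]

theorem comp_lact_dinat (c c' : C.carrier) (a : A.carrier) (b b' : B.carrier) :
    (c ⟶[V] c') ◁ N.obj c' b ◁ M.lact b b' a ≫
        (α_ _ _ _).inv ≫ N.lact c c' b ▷ M.obj b a ≫ compι M N c a b =
      (c ⟶[V] c') ◁ (α_ _ _ _).inv ≫ (c ⟶[V] c') ◁ N.ract c' b b' ▷ M.obj b' a ≫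
          (α_ _ _ _).inv ≫ N.lact c c' b' ▷ M.obj b' a ≫ compι M N c a b' := by
  have e := congrArg (· ▷ M.obj b' a) (N.lact_ract c c' b b')
  simp only [comp_whiskerRight] at e
  rw [associator_inv_naturality_right_assoc, whisker_exchange_assoc, compι_condition,
    associator_inv_naturality_left_assoc, reassoc_of% e]
  simp

theorem comp_ract_dinat (c : C.carrier) (a a' : A.carrier) (b b' : B.carrier) :
    (N.obj c b ◁ M.lact b b' a) ▷ (a ⟶[V] a') ≫
        (α_ _ _ _).hom ≫ N.obj c b ◁ M.ract b a a' ≫ compι M N c a' b =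
      (α_ _ _ _).inv ▷ (a ⟶[V] a') ≫ N.ract c b b' ▷ M.obj b' a ▷ (a ⟶[V] a') ≫
          (α_ _ _ _).hom ≫ N.obj c b' ◁ M.ract b' a a' ≫ compι M N c a' b' := by
  have e := congrArg (N.obj c b ◁ ·) (M.lact_ract b b' a a')
  simp only [MonoidalCategory.whiskerLeft_comp] at e
  rw [associator_naturality_left_assoc, ← whisker_exchange_assoc, compι_condition',
    associator_naturality_middle_assoc, reassoc_of% e]
  simp

variable (M N) in
/-- The action of `C` on the coend. -/
noncomputable def compLact (c c' : C.carrier) (a : A.carrier) :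
    (c ⟶[V] c') ⊗ compObj M N c' a ⟶ compObj M N c a :=
  descL (fun b => (α_ _ _ _).inv ≫ N.lact c c' b ▷ M.obj b a ≫ compι M N c a b)
    (comp_lact_dinat c c' a)

variable (M N) in
/-- The action of `A` on the coend. -/
noncomputable def compRact (c : C.carrier) (a a' : A.carrier) :
    compObj M N c a ⊗ (a ⟶[V] a') ⟶ compObj M N c a' :=
  descR (fun b => (α_ _ _ _).hom ≫ N.obj c b ◁ M.ract b a a' ≫ compι M N c a' b)
    (comp_ract_dinat c a a')

@[simp]
theorem ι_compLact (c c' : C.carrier) (b : B.carrier) (a : A.carrier) :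
    (c ⟶[V] c') ◁ compι M N c' a b ≫ compLact M N c c' a =
      (α_ _ _ _).inv ≫ N.lact c c' b ▷ M.obj b a ≫ compι M N c a b :=
  ι_descL _ _ _

@[simp]
theorem ι_compRact (c : C.carrier) (b : B.carrier) (a a' : A.carrier) :
    compι M N c a b ▷ (a ⟶[V] a') ≫ compRact M N c a a' =
      (α_ _ _ _).hom ≫ N.obj c b ◁ M.ract b a a' ≫ compι M N c a' b :=
  ι_descR _ _ _

variable (M N) in
/-- The composite module `(N ∘ M)(c, a) = ∫^b N(c, b) ⊗ M(b, a)` of `M : A ⟶ B` and `N : B ⟶ C`.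
(The factors may be written in either order by the symmetry of `V`; this order matches the
diagrammatic composition `Hom x y ⊗ Hom y z ⟶ Hom x z` of enriched categories.) -/
noncomputable abbrev compMdl : Mdl A C where
  obj c a := compObj M N c a
  lact c c' a := compLact M N c c' a
  ract c a a' := compRact M N c a a'
  id_lact c a := by
    apply compObj_hom_ext_left
    intro b
    have e := congrArg (· ▷ M.obj b a) (N.id_lact c b)
    simp only [comp_whiskerRight] at e
    rw [whisker_exchange_assoc, ι_compLact, associator_inv_naturality_left_assoc, reassoc_of% e]
    simp
  comp_lact c c' c'' a := by
    apply compObj_hom_ext_left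
    intro b
    have e := congrArg (· ▷ M.obj b a) (N.comp_lact c c' c'' b)
    simp only [comp_whiskerRight] at e
    rw [whisker_exchange_assoc, ι_compLact, associator_inv_naturality_left_assoc, reassoc_of% e,
      associator_naturality_right_assoc, ← MonoidalCategory.whiskerLeft_comp_assoc, ι_compLact]
    simp
  ract_id c a := by
    apply compObj_hom_ext_right
    intro b
    have e := congrArg (N.obj c b ◁ ·) (M.ract_id b a)
    simp only [MonoidalCategory.whiskerLeft_comp] at e
    rw [← whisker_exchange_assoc, ι_compRact, associator_naturality_right_assoc, reassoc_of% e]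
    simp
  ract_comp c a a' a'' := by
    apply compObj_hom_ext_right
    intro b
    have e := congrArg (N.obj c b ◁ ·) (M.ract_comp b a a' a'')
    simp only [MonoidalCategory.whiskerLeft_comp] at e
    rw [← whisker_exchange_assoc, ι_compRact, associator_naturality_right_assoc, reassoc_of% e,
      associator_inv_naturality_left_assoc, ← comp_whiskerRight_assoc, ι_compRact]
    simp
  lact_ract c c' a a' := by
    apply compObj_hom_ext_mid
    intro b
    rw [← comp_whiskerRight_assoc, ι_compLact, associator_naturality_middle_assoc,
      ← MonoidalCategory.whiskerLeft_comp_assoc, ι_compRact]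
    simp only [comp_whiskerRight, Category.assoc, MonoidalCategory.whiskerLeft_comp, ι_compLact,
      ι_compRact]
    rw [associator_naturality_left_assoc, ← whisker_exchange_assoc,
      associator_inv_naturality_right_assoc]
    simp

theorem wL_dinat (M : Mdl A B) {N N' : Mdl B C} (f : N ⟶ N') (c : C.carrier) (a : A.carrier)
    (b b' : B.carrier) :
    N.obj c b ◁ M.lact b b' a ≫ MdlHom.app f c b ▷ M.obj b a ≫ compι M N' c a b =
      (α_ _ _ _).inv ≫ N.ract c b b' ▷ M.obj b' a ≫
        MdlHom.app f c b' ▷ M.obj b' a ≫ compι M N' c a b' := by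
  have e := congrArg (· ▷ M.obj b' a) (MdlHom.ract_app f c b b')
  simp only [comp_whiskerRight] at e
  rw [whisker_exchange_assoc, compι_condition, reassoc_of% e]
  simp

theorem wR_dinat {M M' : Mdl A B} (f : M ⟶ M') (N : Mdl B C) (c : C.carrier) (a : A.carrier)
    (b b' : B.carrier) :
    N.obj c b ◁ M.lact b b' a ≫ N.obj c b ◁ MdlHom.app f b a ≫ compι M' N c a b =
      (α_ _ _ _).inv ≫ N.ract c b b' ▷ M.obj b' a ≫
        N.obj c b' ◁ MdlHom.app f b' a ≫ compι M' N c a b' := by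
  have e := congrArg (N.obj c b ◁ ·) (MdlHom.lact_app f b b' a)
  simp only [MonoidalCategory.whiskerLeft_comp] at e
  rw [reassoc_of% e, compι_condition, ← whisker_exchange_assoc]
  simp

/-- Functoriality of composition in the second module. -/
noncomputable def wL (M : Mdl A B) {N N' : Mdl B C} (f : N ⟶ N') : compMdl M N ⟶ compMdl M N' where
  app c a := compDesc (fun b => MdlHom.app f c b ▷ M.obj b a ≫ compι M N' c a b) (wL_dinat M f c a)
  lact_app c c' a := by
    apply compObj_hom_ext_left
    intro b
    have e := congrArg (· ▷ M.obj b a) (MdlHom.lact_app f c c' b)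
    simp only [comp_whiskerRight] at e
    dsimp
    rw [reassoc_of% ι_compLact, compι_desc, reassoc_of% e,
      ← MonoidalCategory.whiskerLeft_comp_assoc, compι_desc]
    simp
  ract_app c a a' := by
    apply compObj_hom_ext_right
    intro b
    dsimp
    rw [reassoc_of% ι_compRact, compι_desc, whisker_exchange_assoc, ← comp_whiskerRight_assoc,
      compι_desc]
    simp

/-- Functoriality of composition in the first module. -/
noncomputable def wR {M M' : Mdl A B} (f : M ⟶ M') (N : Mdl B C) :
    compMdl M N ⟶ compMdl M' N where
  app c a := compDesc (fun b => N.obj c b ◁ MdlHom.app f b a ≫ compι M' N c a b) (wR_dinat f N c a)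
  lact_app c c' a := by
    apply compObj_hom_ext_left
    intro b
    dsimp
    rw [reassoc_of% ι_compLact, compι_desc, ← whisker_exchange_assoc,
      ← MonoidalCategory.whiskerLeft_comp_assoc, compι_desc]
    simp
  ract_app c a a' := by
    apply compObj_hom_ext_right
    intro b
    have e := congrArg (N.obj c b ◁ ·) (MdlHom.ract_app f b a a')
    simp only [MonoidalCategory.whiskerLeft_comp] at e
    dsimp
    rw [reassoc_of% ι_compRact, compι_desc, reassoc_of% e, ← comp_whiskerRight_assoc,
      compι_desc]
    simp

@[simp]
theorem ι_wL (M : Mdl A B) {N N' : Mdl B C} (f : N ⟶ N') (c : C.carrier) (b : B.carrier)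
    (a : A.carrier) : compι M N c a b ≫ MdlHom.app (wL M f) c a =
      MdlHom.app f c b ▷ M.obj b a ≫ compι M N' c a b :=
  compι_desc _ (wL_dinat M f c a) _

@[simp]
theorem ι_wR {M M' : Mdl A B} (f : M ⟶ M') (N : Mdl B C) (c : C.carrier) (b : B.carrier)
    (a : A.carrier) : compι M N c a b ≫ MdlHom.app (wR f N) c a =
      N.obj c b ◁ MdlHom.app f b a ≫ compι M' N c a b :=
  compι_desc _ (wR_dinat f N c a) _

/-! ### Unitors and associators -/

/-- The morphism `∫^x M(b, x) ⊗ A(x, a) ⟶ M(b, a)` given by the action of `A`. -/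
noncomputable def lunitHom (M : Mdl A B) : compMdl (idMdl A) M ⟶ M where
  app b a := compDesc (fun x => M.ract b x a) (fun x x' => M.ract_comp b x x' a)
  lact_app b b' a := by
    apply compObj_hom_ext_left
    intro x
    dsimp
    rw [reassoc_of% ι_compLact, compι_desc, ← MonoidalCategory.whiskerLeft_comp_assoc, compι_desc,
      M.lact_ract]
    simp
  ract_app b a a' := by
    apply compObj_hom_ext_right
    intro x
    dsimp
    rw [reassoc_of% ι_compRact, compι_desc, ← comp_whiskerRight_assoc, compι_desc]
    dsimp
    rw [M.ract_comp]
    simp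

@[simp]
theorem ι_lunitHom (M : Mdl A B) (b : B.carrier) (a x : A.carrier) :
    compι (idMdl A) M b a x ≫ MdlHom.app (lunitHom M) b a = M.ract b x a :=
  compι_desc (M := idMdl A) (N := M) _ (fun x x' => M.ract_comp b x x' a) _

/-- The left unitor. -/
noncomputable def lunit (M : Mdl A B) : compMdl (idMdl A) M ≅ M :=
  Mdl.isoMk (lunitHom M)
    (fun b a => (ρ_ _).inv ≫ M.obj b a ◁ eId V a ≫ compι (idMdl A) M b a a)
    (by
      intro b a
      apply compObj_hom_ext
      intro x
      rw [reassoc_of% ι_lunitHom]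
      have e := compι_condition' (M := idMdl A) (N := M) (c := b) (a := a) x a
      dsimp at e
      rw [rightUnitor_inv_naturality_assoc, ← whisker_exchange_assoc, e,
        associator_naturality_right_assoc, ← MonoidalCategory.whiskerLeft_comp_assoc]
      have e2 := congrArg (M.obj b x ◁ ·) (e_comp_id V x a)
      simp only [MonoidalCategory.whiskerLeft_comp] at e2
      simp only [MonoidalCategory.whiskerLeft_comp, Category.assoc]
      rw [MonoidalCategory.rightUnitor_tensor_inv]
      simp only [Category.assoc, Iso.inv_hom_id_assoc]
      rw [reassoc_of% e2]
      simp)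
    (by
      intro b a
      simp [M.ract_id])

theorem runit_dinat (M : Mdl A B) (b : B.carrier) (a : A.carrier) (x x' : B.carrier) :
    (b ⟶[V] x) ◁ M.lact x x' a ≫ M.lact b x a =
      (α_ _ _ _).inv ≫ eComp V b x x' ▷ M.obj x' a ≫ M.lact b x' a := by
  rw [M.comp_lact]
  simp

/-- The morphism `∫^y B(b, y) ⊗ M(y, a) ⟶ M(b, a)` given by the action of `B`. -/
noncomputable def runitHom (M : Mdl A B) : compMdl M (idMdl B) ⟶ M where
  app b a := compDesc (fun x => M.lact b x a) (runit_dinat M b a)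
  lact_app b b' a := by
    apply compObj_hom_ext_left
    intro x
    dsimp
    rw [reassoc_of% ι_compLact, compι_desc, ← MonoidalCategory.whiskerLeft_comp_assoc, compι_desc]
    dsimp
    rw [M.comp_lact]
    simp
  ract_app b a a' := by
    apply compObj_hom_ext_right
    intro x
    dsimp
    rw [reassoc_of% ι_compRact, compι_desc, ← comp_whiskerRight_assoc, compι_desc]
    dsimp
    rw [M.lact_ract]

@[simp]
theorem ι_runitHom (M : Mdl A B) (b x : B.carrier) (a : A.carrier) :
    compι M (idMdl B) b a x ≫ MdlHom.app (runitHom M) b a = M.lact b x a :=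
  compι_desc (M := M) (N := idMdl B) _ (runit_dinat M b a) _

/-- The right unitor. -/
noncomputable def runit (M : Mdl A B) : compMdl M (idMdl B) ≅ M :=
  Mdl.isoMk (runitHom M)
    (fun b a => (λ_ _).inv ≫ eId V b ▷ M.obj b a ≫ compι M (idMdl B) b a b)
    (by
      intro b a
      apply compObj_hom_ext
      intro x
      rw [reassoc_of% ι_runitHom]
      have e := compι_condition (M := M) (N := idMdl B) (c := b) (a := a) b x
      dsimp at e
      rw [leftUnitor_inv_naturality_assoc, whisker_exchange_assoc, e,
        associator_inv_naturality_left_assoc, ← comp_whiskerRight_assoc]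
      have e2 := congrArg (· ▷ M.obj x a) (e_id_comp V b x)
      simp only [comp_whiskerRight] at e2
      simp only [comp_whiskerRight, Category.assoc]
      rw [MonoidalCategory.leftUnitor_tensor_inv]
      simp only [Category.assoc, Iso.hom_inv_id_assoc]
      rw [reassoc_of% e2]
      simp)
    (by
      intro b a
      simp [M.id_lact])

variable {D : VMod.{w} V}

theorem assoc_dinat₁ (M : Mdl A B) (N : Mdl B C) (K : Mdl C D) (d : D.carrier) (c : C.carrier)
    (a : A.carrier) (b b' : B.carrier) :
    K.obj d c ◁ N.obj c b ◁ M.lact b b' a ≫ (α_ _ _ _).inv ≫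
        compι N K d b c ▷ M.obj b a ≫ compι M (compMdl N K) d a b =
      K.obj d c ◁ (α_ _ _ _).inv ≫ K.obj d c ◁ N.ract c b b' ▷ M.obj b' a ≫ (α_ _ _ _).inv ≫
        compι N K d b' c ▷ M.obj b' a ≫ compι M (compMdl N K) d a b' := by
  have e := compι_condition (M := M) (N := compMdl N K) (c := d) (a := a) b b'
  have e2 := congrArg (· ▷ M.obj b' a) (ι_compRact (M := N) (N := K) d c b b')
  simp only [comp_whiskerRight] at e2
  dsimp at e
  rw [associator_inv_naturality_right_assoc, whisker_exchange_assoc, e,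
    associator_inv_naturality_left_assoc, reassoc_of% e2]
  simp

theorem assoc_dinat₂ (M : Mdl A B) (N : Mdl B C) (K : Mdl C D) (d : D.carrier) (b : B.carrier)
    (a : A.carrier) (c c' : C.carrier) :
    (K.obj d c ◁ N.lact c c' b) ▷ M.obj b a ≫ (α_ _ _ _).hom ≫
        K.obj d c ◁ compι M N c a b ≫ compι (compMdl M N) K d a c =
      (α_ _ _ _).inv ▷ M.obj b a ≫ K.ract d c c' ▷ N.obj c' b ▷ M.obj b a ≫ (α_ _ _ _).hom ≫
        K.obj d c' ◁ compι M N c' a b ≫ compι (compMdl M N) K d a c' := by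
  have e := compι_condition' (M := compMdl M N) (N := K) (c := d) (a := a) c c'
  have e2 := congrArg (K.obj d c ◁ ·) (ι_compLact (M := M) (N := N) c c' b a)
  simp only [MonoidalCategory.whiskerLeft_comp] at e2
  dsimp at e
  rw [associator_naturality_left_assoc, ← whisker_exchange_assoc, e,
    associator_naturality_right_assoc, reassoc_of% e2]
  simp

/-- The component of the associator on `K(d, c) ⊗ ∫^b N(c, b) ⊗ M(b, a)`. -/
noncomputable def assocApp₁ (M : Mdl A B) (N : Mdl B C) (K : Mdl C D) (d : D.carrier)
    (c : C.carrier) (a : A.carrier) :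
    K.obj d c ⊗ compObj M N c a ⟶ compObj M (compMdl N K) d a :=
  descL (fun b => (α_ _ _ _).inv ≫ compι N K d b c ▷ M.obj b a ≫ compι M (compMdl N K) d a b)
    (assoc_dinat₁ M N K d c a)

@[simp]
theorem ι_assocApp₁ (M : Mdl A B) (N : Mdl B C) (K : Mdl C D) (d : D.carrier)
    (c : C.carrier) (b : B.carrier) (a : A.carrier) :
    K.obj d c ◁ compι M N c a b ≫ assocApp₁ M N K d c a =
      (α_ _ _ _).inv ≫ compι N K d b c ▷ M.obj b a ≫ compι M (compMdl N K) d a b :=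
  ι_descL _ (assoc_dinat₁ M N K d c a) _

/-- The component of the inverse associator on `(∫^c K(d, c) ⊗ N(c, b)) ⊗ M(b, a)`. -/
noncomputable def assocApp₂ (M : Mdl A B) (N : Mdl B C) (K : Mdl C D) (d : D.carrier)
    (b : B.carrier) (a : A.carrier) :
    compObj N K d b ⊗ M.obj b a ⟶ compObj (compMdl M N) K d a :=
  descR (fun c => (α_ _ _ _).hom ≫ K.obj d c ◁ compι M N c a b ≫ compι (compMdl M N) K d a c)
    (assoc_dinat₂ M N K d b a)

@[simp]
theorem ι_assocApp₂ (M : Mdl A B) (N : Mdl B C) (K : Mdl C D) (d : D.carrier)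
    (c : C.carrier) (b : B.carrier) (a : A.carrier) :
    compι N K d b c ▷ M.obj b a ≫ assocApp₂ M N K d b a =
      (α_ _ _ _).hom ≫ K.obj d c ◁ compι M N c a b ≫ compι (compMdl M N) K d a c :=
  ι_descR _ (assoc_dinat₂ M N K d b a) _

theorem assocApp₁_dinat (M : Mdl A B) (N : Mdl B C) (K : Mdl C D) (d : D.carrier) (a : A.carrier)
    (c c' : C.carrier) :
    K.obj d c ◁ compLact M N c c' a ≫ assocApp₁ M N K d c a =
      (α_ _ _ _).inv ≫ K.ract d c c' ▷ compObj M N c' a ≫ assocApp₁ M N K d c' a := by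
  rw [← cancel_epi (α_ _ _ _).hom]
  apply compObj_hom_ext_left
  intro b
  have e := congrArg (· ▷ M.obj b a) (compι_condition (M := N) (N := K) (c := d) (a := b) c c')
  simp only [comp_whiskerRight] at e
  rw [associator_naturality_right_assoc, ← MonoidalCategory.whiskerLeft_comp_assoc, ι_compLact]
  simp only [Iso.hom_inv_id_assoc]
  rw [whisker_exchange_assoc]
  simp only [MonoidalCategory.whiskerLeft_comp, Category.assoc, ι_assocApp₁]
  rw [associator_inv_naturality_middle_assoc, reassoc_of% e]
  simp

@[simp]
theorem assocHom_lact (M : Mdl A B) (N : Mdl B C) (K : Mdl C D) (d d' : D.carrier) (c : C.carrier)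
    (a : A.carrier) :
    (d ⟶[V] d') ◁ assocApp₁ M N K d' c a ≫ compLact M (compMdl N K) d d' a =
      (α_ _ _ _).inv ≫ K.lact d d' c ▷ compObj M N c a ≫ assocApp₁ M N K d c a := by
  rw [← cancel_epi (α_ _ _ _).hom]
  apply compObj_hom_ext_left
  intro b
  have e := congrArg (· ▷ M.obj b a) (ι_compLact (M := N) (N := K) d d' c b)
  simp only [comp_whiskerRight] at e
  rw [associator_naturality_right_assoc, ← MonoidalCategory.whiskerLeft_comp_assoc, ι_assocApp₁]
  simp only [Iso.hom_inv_id_assoc]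
  rw [whisker_exchange_assoc]
  simp only [MonoidalCategory.whiskerLeft_comp, Category.assoc, ι_assocApp₁, ι_compLact]
  rw [associator_inv_naturality_middle_assoc, reassoc_of% e]
  simp

theorem assocHom_ract (M : Mdl A B) (N : Mdl B C) (K : Mdl C D) (d : D.carrier) (c : C.carrier)
    (a a' : A.carrier) :
    assocApp₁ M N K d c a ▷ (a ⟶[V] a') ≫ compRact M (compMdl N K) d a a' =
      (α_ _ _ _).hom ≫ K.obj d c ◁ compRact M N c a a' ≫ assocApp₁ M N K d c a' := by
  apply compObj_hom_ext_mid
  intro b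
  rw [← comp_whiskerRight_assoc, ι_assocApp₁, associator_naturality_middle_assoc,
    ← MonoidalCategory.whiskerLeft_comp_assoc, ι_compRact]
  simp only [MonoidalCategory.whiskerLeft_comp, comp_whiskerRight, Category.assoc, ι_assocApp₁,
    ι_compRact]
  rw [associator_naturality_left_assoc, ← whisker_exchange_assoc]
  simp

/-- The associator morphism, given on `K(d, c) ⊗ (N(c, b) ⊗ M(b, a))` by the associator of `V`. -/
noncomputable def assocHom (M : Mdl A B) (N : Mdl B C) (K : Mdl C D) :
    compMdl (compMdl M N) K ⟶ compMdl M (compMdl N K) where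
  app d a := compDesc (fun c => assocApp₁ M N K d c a) (assocApp₁_dinat M N K d a)
  lact_app d d' a := by
    apply compObj_hom_ext_left
    intro c
    dsimp
    rw [reassoc_of% ι_compLact, compι_desc, ← MonoidalCategory.whiskerLeft_comp_assoc, compι_desc,
      assocHom_lact]
  ract_app d a a' := by
    apply compObj_hom_ext_right
    intro c
    dsimp
    rw [reassoc_of% ι_compRact, compι_desc, ← comp_whiskerRight_assoc, compι_desc, assocHom_ract]

@[simp]
theorem ι_assocHom (M : Mdl A B) (N : Mdl B C) (K : Mdl C D) (d : D.carrier) (a : A.carrier)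
    (c : C.carrier) : compι (compMdl M N) K d a c ≫ MdlHom.app (assocHom M N K) d a =
      assocApp₁ M N K d c a :=
  compι_desc _ (assocApp₁_dinat M N K d a) _

theorem assocApp₂_dinat (M : Mdl A B) (N : Mdl B C) (K : Mdl C D) (d : D.carrier) (a : A.carrier)
    (b b' : B.carrier) :
    compObj N K d b ◁ M.lact b b' a ≫ assocApp₂ M N K d b a =
      (α_ _ _ _).inv ≫ compRact N K d b b' ▷ M.obj b' a ≫ assocApp₂ M N K d b' a := by
  apply compObj_hom_ext_right
  intro c
  have e := congrArg (K.obj d c ◁ ·) (compι_condition (M := M) (N := N) (c := c) (a := a) b b')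
  simp only [MonoidalCategory.whiskerLeft_comp] at e
  rw [← whisker_exchange_assoc, ι_assocApp₂, associator_naturality_right_assoc, reassoc_of% e,
    associator_inv_naturality_left_assoc, ← comp_whiskerRight_assoc, ι_compRact]
  simp

/-- The inverse of the associator. -/
noncomputable def assocInvApp (M : Mdl A B) (N : Mdl B C) (K : Mdl C D) (d : D.carrier)
    (a : A.carrier) : compObj M (compMdl N K) d a ⟶ compObj (compMdl M N) K d a :=
  compDesc (fun b => assocApp₂ M N K d b a) (assocApp₂_dinat M N K d a)

@[simp]
theorem ι_assocInvApp (M : Mdl A B) (N : Mdl B C) (K : Mdl C D) (d : D.carrier) (b : B.carrier)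
    (a : A.carrier) : compι M (compMdl N K) d a b ≫ assocInvApp M N K d a =
      assocApp₂ M N K d b a :=
  compι_desc _ (assocApp₂_dinat M N K d a) _

/-- The associator. -/
noncomputable def assoc (M : Mdl A B) (N : Mdl B C) (K : Mdl C D) :
    compMdl (compMdl M N) K ≅ compMdl M (compMdl N K) :=
  Mdl.isoMk (assocHom M N K)
    (assocInvApp M N K)
    (by
      intro d a
      apply compObj_hom_ext
      intro c
      apply compObj_hom_ext_left
      intro b
      rw [reassoc_of% ι_assocHom, reassoc_of% ι_assocApp₁, ι_assocInvApp, ι_assocApp₂]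
      simp)
    (by
      intro d a
      apply compObj_hom_ext
      intro b
      apply compObj_hom_ext_right
      intro c
      rw [reassoc_of% ι_assocInvApp, reassoc_of% ι_assocApp₂, ι_assocHom, ι_assocApp₁]
      simp)

@[simp]
theorem lunit_hom (M : Mdl A B) : (lunit M).hom = lunitHom M := rfl

@[simp]
theorem runit_hom (M : Mdl A B) : (runit M).hom = runitHom M := rfl

@[simp]
theorem assoc_hom (M : Mdl A B) (N : Mdl B C) (K : Mdl C D) :
    (assoc M N K).hom = assocHom M N K := rfl

theorem compMdl_hom_ext {M : Mdl A B} {N : Mdl B C} {K : Mdl A C} {f g : compMdl M N ⟶ K}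
    (h : ∀ c a b, compι M N c a b ≫ MdlHom.app f c a = compι M N c a b ≫ MdlHom.app g c a) :
    f = g :=
  Mdl.hom_ext fun c a => compObj_hom_ext (h c a)

theorem compMdl_hom_ext₂ {M : Mdl A B} {N : Mdl B C} {K : Mdl C D} {L : Mdl A D}
    {f g : compMdl (compMdl M N) K ⟶ L}
    (h : ∀ d a c b, K.obj d c ◁ compι M N c a b ≫ compι (compMdl M N) K d a c ≫ MdlHom.app f d a =
      K.obj d c ◁ compι M N c a b ≫ compι (compMdl M N) K d a c ≫ MdlHom.app g d a) :
    f = g :=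
  compMdl_hom_ext fun d a c => compObj_hom_ext_left (h d a c)

theorem wL_id (M : Mdl A B) (N : Mdl B C) : wL M (𝟙 N) = 𝟙 _ := by
  apply compMdl_hom_ext
  intro c a b
  simp

theorem wL_comp (M : Mdl A B) {N N' N'' : Mdl B C} (f : N ⟶ N') (g : N' ⟶ N'') :
    wL M (f ≫ g) = wL M f ≫ wL M g := by
  apply compMdl_hom_ext
  intro c a b
  simp [reassoc_of% ι_wL]

theorem wR_id (M : Mdl A B) (N : Mdl B C) : wR (𝟙 M) N = 𝟙 _ := by
  apply compMdl_hom_ext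
  intro c a b
  simp

theorem wR_comp {M M' M'' : Mdl A B} (f : M ⟶ M') (g : M' ⟶ M'') (N : Mdl B C) :
    wR (f ≫ g) N = wR f N ≫ wR g N := by
  apply compMdl_hom_ext
  intro c a b
  simp [reassoc_of% ι_wR]

theorem w_exchange {M M' : Mdl A B} {N N' : Mdl B C} (f : M ⟶ M') (g : N ⟶ N') :
    wL M g ≫ wR f N' = wR f N ≫ wL M' g := by
  apply compMdl_hom_ext
  intro c a b
  simp [reassoc_of% ι_wR, reassoc_of% ι_wL, whisker_exchange_assoc]

theorem lunit_nat {M N : Mdl A B} (f : M ⟶ N) :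
    wL (idMdl A) f ≫ lunitHom N = lunitHom M ≫ f := by
  apply compMdl_hom_ext
  intro c a b
  simp [reassoc_of% ι_wL, reassoc_of% ι_lunitHom, MdlHom.ract_app]

theorem runit_nat {M N : Mdl A B} (f : M ⟶ N) :
    wR f (idMdl B) ≫ runitHom N = runitHom M ≫ f := by
  apply compMdl_hom_ext
  intro c a b
  simp [reassoc_of% ι_wR, reassoc_of% ι_runitHom, MdlHom.lact_app]

theorem assoc_nat₁ {M M' : Mdl A B} (f : M ⟶ M') (N : Mdl B C) (K : Mdl C D) :
    wR (wR f N) K ≫ assocHom M' N K = assocHom M N K ≫ wR f (compMdl N K) := by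
  apply compMdl_hom_ext₂
  intro d a c b
  simp only [Mdl.comp_app, reassoc_of% ι_wR, reassoc_of% ι_assocHom, ι_assocHom,
    reassoc_of% ι_assocApp₁, ← MonoidalCategory.whiskerLeft_comp_assoc, ι_wR]
  have e := whisker_exchange (compι N K d b c) (MdlHom.app f b a)
  simp only [MonoidalCategory.whiskerLeft_comp, Category.assoc, ι_assocApp₁, ι_wR]
  rw [← reassoc_of% e, associator_inv_naturality_right_assoc]

theorem assoc_nat₂ (M : Mdl A B) {N N' : Mdl B C} (f : N ⟶ N') (K : Mdl C D) :
    wR (wL M f) K ≫ assocHom M N' K = assocHom M N K ≫ wL M (wR f K) := by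
  apply compMdl_hom_ext₂
  intro d a c b
  simp only [Mdl.comp_app, reassoc_of% ι_wR, reassoc_of% ι_assocHom, ι_assocHom,
    reassoc_of% ι_assocApp₁, ← MonoidalCategory.whiskerLeft_comp_assoc, ι_wL]
  simp [← comp_whiskerRight_assoc]

theorem assoc_nat₃ (M : Mdl A B) (N : Mdl B C) {K K' : Mdl C D} (f : K ⟶ K') :
    wL (compMdl M N) f ≫ assocHom M N K' = assocHom M N K ≫ wL M (wL N f) := by
  apply compMdl_hom_ext₂
  intro d a c b
  simp only [Mdl.comp_app, reassoc_of% ι_wL, reassoc_of% ι_assocHom, ι_assocHom,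
    reassoc_of% ι_assocApp₁, whisker_exchange_assoc, ι_assocApp₁, ι_wL]
  rw [← comp_whiskerRight_assoc, ι_wL, associator_inv_naturality_left_assoc]
  simp

theorem mdl_triangle (M : Mdl A B) (N : Mdl B C) :
    assocHom M (idMdl B) N ≫ wL M (lunitHom N) = wR (runitHom M) N := by
  apply compMdl_hom_ext₂
  intro d a c b
  simp only [Mdl.comp_app, reassoc_of% ι_assocHom, 
    reassoc_of% ι_assocApp₁, ι_wL, ι_wR, ← MonoidalCategory.whiskerLeft_comp_assoc, ι_runitHom,
    ← comp_whiskerRight_assoc, ι_lunitHom, compι_condition]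

theorem mdl_pentagon {E : VMod.{w} V} (M : Mdl A B) (N : Mdl B C) (K : Mdl C D) (L : Mdl D E) :
    wR (assocHom M N K) L ≫ assocHom M (compMdl N K) L ≫ wL M (assocHom N K L) =
      assocHom (compMdl M N) K L ≫ assocHom M N (compMdl K L) := by
  apply compMdl_hom_ext₂
  intro e a d c
  rw [← cancel_epi (α_ _ _ _).hom]
  apply compObj_hom_ext_left
  intro b
  have e1 := congrArg (L.obj e d ◁ ·) (ι_assocApp₁ M N K d c b a)
  have e2 := congrArg (· ▷ M.obj b a) (ι_assocApp₁ N K L e d c b)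
  have e3 := whisker_exchange (compι K L e c d) (compι M N c a b)
  have e4 := ι_assocApp₁ M N (compMdl K L) e c b a
  dsimp at e4
  simp only [MonoidalCategory.whiskerLeft_comp] at e1
  simp only [comp_whiskerRight] at e2
  simp only [Mdl.comp_app, reassoc_of% ι_wR, reassoc_of% ι_assocHom, ι_assocHom, ι_wL,
    reassoc_of% ι_assocApp₁]
  rw [← MonoidalCategory.whiskerLeft_comp_assoc, ι_assocHom,
    associator_naturality_right_assoc, reassoc_of% e1, reassoc_of% ι_assocApp₁, ι_wL,
    ← comp_whiskerRight_assoc, ι_assocHom, associator_inv_naturality_middle_assoc,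
    reassoc_of% e2, Iso.hom_inv_id_assoc, reassoc_of% e3, e4,
    associator_inv_naturality_left_assoc]
  simp

end Comp

section Bicat

variable {V : Type u} [Category.{v} V] [MonoidalCategory V] [SymmetricCategory V]
  [MonoidalClosed V] [HasColimitsOfSize.{w, w} V]

/-- The bicategory `V`-Mod: objects are the small `V`-categories, 1-morphisms the modules,
2-morphisms the module morphisms. Composition is written in diagrammatic order, so that
`M ≫ N` is `N ∘ M`. -/
noncomputable instance bicategoryVMod : Bicategory (VMod.{w} V) where
  Hom A B := Mdl A B
  id A := idMdl A
  comp M N := compMdl M N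
  whiskerLeft M _ _ f := wL M f
  whiskerRight f N := wR f N
  associator M N K := assoc M N K
  leftUnitor M := lunit M
  rightUnitor M := runit M
  whiskerLeft_id M N := wL_id M N
  whiskerLeft_comp M _ _ _ f g := wL_comp M f g
  id_whiskerLeft f := 
    ((Iso.eq_comp_inv (lunit _)).2 (lunit_nat f)).trans (Category.assoc _ _ _)
  comp_whiskerLeft M N _ _ f := 
    ((Iso.eq_comp_inv (assoc M N _)).2 (assoc_nat₃ M N f)).trans (Category.assoc _ _ _)
  id_whiskerRight M N := wR_id M N
  comp_whiskerRight f g N := wR_comp f g N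
  whiskerRight_id f :=
    ((Iso.eq_comp_inv (runit _)).2 (runit_nat f)).trans (Category.assoc _ _ _)
  whiskerRight_comp f N K := (Iso.eq_inv_comp (assoc _ N K)).2 (assoc_nat₁ f N K).symm
  whisker_assoc M _ _ f K :=
    ((Iso.eq_comp_inv (assoc M _ K)).2 (assoc_nat₂ M f K)).trans (Category.assoc _ _ _)
  whisker_exchange f g := w_exchange f g
  pentagon M N K L := mdl_pentagon M N K L
  triangle M N := mdl_triangle M N

end Bicat

section Stars

variable {V : Type u} [Category.{v} V] [MonoidalCategory V] [SymmetricCategory V]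
  [MonoidalClosed V] [HasColimitsOfSize.{w, w} V]

/-- The module `F_*(b, a) = B(b, F a)`. -/
abbrev lowerStar {A B : VMod.{w} V} (F : EnrichedFunctor V A.carrier B.carrier) : Mdl A B where
  obj b a := b ⟶[V] F.obj a
  lact b b' a := eComp V b b' (F.obj a)
  ract b a a' := (b ⟶[V] F.obj a) ◁ F.map a a' ≫ eComp V b (F.obj a) (F.obj a')
  id_lact b a := (idMdl B).id_lact b (F.obj a)
  comp_lact b b' b'' a := (idMdl B).comp_lact b b' b'' (F.obj a)
  ract_id b a := by
    rw [← MonoidalCategory.whiskerLeft_comp_assoc, F.map_id]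
    exact (idMdl B).ract_id b (F.obj a)
  ract_comp b a a' a'' := by
    have e := (idMdl B).ract_comp b (F.obj a) (F.obj a') (F.obj a'')
    dsimp at e
    rw [← MonoidalCategory.whiskerLeft_comp_assoc, F.map_comp,
      MonoidalCategory.whiskerLeft_comp_assoc, e]
    simp [MonoidalCategory.tensorHom_def, ← whisker_exchange_assoc]
  lact_ract b b' a a' := by
    have e := (idMdl B).lact_ract b b' (F.obj a) (F.obj a')
    dsimp at e
    rw [← whisker_exchange_assoc, e]
    simp

/-- The module `F^*(a, b) = B(F a, b)`. -/
abbrev upperStar {A B : VMod.{w} V} (F : EnrichedFunctor V A.carrier B.carrier) : Mdl B A where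
  obj a b := F.obj a ⟶[V] b
  lact a a' b := F.map a a' ▷ (F.obj a' ⟶[V] b) ≫ eComp V (F.obj a) (F.obj a') b
  ract a b b' := eComp V (F.obj a) b b'
  id_lact a b := by
    rw [← comp_whiskerRight_assoc, F.map_id]
    exact (idMdl B).id_lact (F.obj a) b
  comp_lact a a' a'' b := by
    have e := (idMdl B).comp_lact (F.obj a) (F.obj a') (F.obj a'') b
    dsimp at e
    rw [← comp_whiskerRight_assoc, F.map_comp, comp_whiskerRight_assoc, e]
    simp [MonoidalCategory.tensorHom_def', whisker_exchange_assoc]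
  ract_id a b := (idMdl B).ract_id (F.obj a) b
  ract_comp a b b' b'' := (idMdl B).ract_comp (F.obj a) b b' b''
  lact_ract a a' b b' := by
    have e := (idMdl B).lact_ract (F.obj a) (F.obj a') b b'
    dsimp at e
    rw [comp_whiskerRight_assoc, e, whisker_exchange_assoc]
    simp

section Adj

variable {A B : VMod.{w} V} (F : EnrichedFunctor V A.carrier B.carrier)

/-- The unit of `F_* ⊣ F^*`: the morphism `A(a', a) ⟶ ∫^b B(F a', b) ⊗ B(b, F a)` induced by the
action of `F` on homs. -/
noncomputable def starUnit : idMdl A ⟶ compMdl (lowerStar F) (upperStar F) where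
  app a' a := F.map a' a ≫ (ρ_ _).inv ≫ (F.obj a' ⟶[V] F.obj a) ◁ eId V (F.obj a) ≫
    compι (lowerStar F) (upperStar F) a' a (F.obj a)
  lact_app a a' a'' := by
    simp only [MonoidalCategory.whiskerLeft_comp, Category.assoc, ι_compLact, comp_whiskerRight]
    rw [associator_inv_naturality_right_assoc, whisker_exchange_assoc, whisker_exchange_assoc,
      F.map_comp_assoc, MonoidalCategory.tensorHom_def']
    simp
  ract_app a a' a'' := by
    have e := compι_condition' (M := lowerStar F) (N := upperStar F) (c := a) (a := a'')
      (F.obj a') (F.obj a'')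
    dsimp at e
    have e2 := congrArg ((F.obj a ⟶[V] F.obj a') ◁ ·) (e_comp_id V (F.obj a') (F.obj a''))
    have e3 := congrArg ((F.obj a ⟶[V] F.obj a') ◁ ·) (e_id_comp V (F.obj a') (F.obj a''))
    simp only [MonoidalCategory.whiskerLeft_comp, MonoidalCategory.whiskerLeft_id] at e2 e3
    simp only [comp_whiskerRight, Category.assoc, ι_compRact]
    rw [F.map_comp_assoc, rightUnitor_inv_naturality_assoc, ← whisker_exchange_assoc, e]
    simp only [MonoidalCategory.tensorHom_def, Category.assoc,
      MonoidalCategory.rightUnitor_tensor_inv, MonoidalCategory.whiskerLeft_comp,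
      Iso.inv_hom_id_assoc, associator_naturality_right_assoc, reassoc_of% e2]
    rw [← associator_naturality_right_assoc,
      ← whisker_exchange_assoc ((F.obj a ⟶[V] F.obj a') ◁ eId V (F.obj a')) (F.map a' a''),
      associator_naturality_middle_assoc,
      ← whisker_exchange_assoc (ρ_ (F.obj a ⟶[V] F.obj a')).inv (F.map a' a'')]
    have e4 : (ρ_ (F.obj a ⟶[V] F.obj a')).inv ▷ (F.obj a' ⟶[V] F.obj a'') ≫ (α_ _ _ _).hom =
      (F.obj a ⟶[V] F.obj a') ◁ (λ_ (F.obj a' ⟶[V] F.obj a'')).inv := by simp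
    rw [reassoc_of% e4, reassoc_of% e3]

theorem starCounit_dinat (b b' : B.carrier) (a a' : A.carrier) :
    (b ⟶[V] F.obj a) ◁ (F.map a a' ▷ (F.obj a' ⟶[V] b') ≫ eComp V (F.obj a) (F.obj a') b') ≫
        eComp V b (F.obj a) b' =
      (α_ _ _ _).inv ≫ ((b ⟶[V] F.obj a) ◁ F.map a a' ≫ eComp V b (F.obj a) (F.obj a')) ▷
        (F.obj a' ⟶[V] b') ≫ eComp V b (F.obj a') b' := by
  have e := (idMdl B).ract_comp b (F.obj a) (F.obj a') b'
  dsimp at e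
  rw [MonoidalCategory.whiskerLeft_comp_assoc, e]
  simp

/-- The counit of `F_* ⊣ F^*`: the morphism `∫^a B(b, F a) ⊗ B(F a, b') ⟶ B(b, b')` induced by
composition. -/
noncomputable def starCounit : compMdl (upperStar F) (lowerStar F) ⟶ idMdl B where
  app b b' := compDesc (fun a => eComp V b (F.obj a) b') (starCounit_dinat F b b')
  lact_app b b' b'' := by
    apply compObj_hom_ext_left
    intro a
    have e := (idMdl B).comp_lact b b' (F.obj a) b''
    dsimp at e ⊢
    rw [reassoc_of% ι_compLact, compι_desc, ← MonoidalCategory.whiskerLeft_comp_assoc, compι_desc,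
      e]
    simp
  ract_app b b' b'' := by
    apply compObj_hom_ext_right
    intro a
    have e := (idMdl B).lact_ract b (F.obj a) b' b''
    dsimp at e ⊢
    rw [reassoc_of% ι_compRact, compι_desc, ← comp_whiskerRight_assoc, compι_desc, e]

@[simp]
theorem ι_starCounit (b b' : B.carrier) (a : A.carrier) :
    compι (upperStar F) (lowerStar F) b b' a ≫ MdlHom.app (starCounit F) b b' =
      eComp V b (F.obj a) b' :=
  compι_desc (M := upperStar F) (N := lowerStar F) _ (starCounit_dinat F b b') _

theorem star_left : wR (starUnit F) (lowerStar F) ≫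
    assocHom (lowerStar F) (upperStar F) (lowerStar F) ≫ wL (lowerStar F) (starCounit F) =
      lunitHom (lowerStar F) ≫ (runit (lowerStar F)).inv := by
  simp only [← Category.assoc]
  rw [Iso.eq_comp_inv, runit_hom]
  apply compMdl_hom_ext
  intro b a a'
  simp only [Mdl.comp_app, Category.assoc]
  rw [reassoc_of% (ι_wR (starUnit F) (lowerStar F) b a' a),
    reassoc_of% (ι_assocHom (lowerStar F) (upperStar F) (lowerStar F) b a a')]
  have e1 := congrArg (· ▷ (F.obj a ⟶[V] F.obj a)) (ι_starCounit F b (F.obj a) a')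
  simp only [comp_whiskerRight] at e1
  simp only [starUnit, MonoidalCategory.whiskerLeft_comp, Category.assoc]
  rw [reassoc_of% (ι_assocApp₁ (lowerStar F) (upperStar F) (lowerStar F)),
    reassoc_of% (ι_wL (lowerStar F) (starCounit F)), reassoc_of% e1,
    ι_runitHom, ι_lunitHom]
  have e2 := congrArg ((b ⟶[V] F.obj a') ◁ ·) (e_comp_id V (F.obj a') (F.obj a))
  simp only [MonoidalCategory.whiskerLeft_comp, MonoidalCategory.whiskerLeft_id] at e2
  have e3 := e_assoc V b (F.obj a') (F.obj a) (F.obj a)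
  dsimp
  rw [e3, reassoc_of% e2]

theorem star_right : wL (upperStar F) (starUnit F) ≫
    (assoc (upperStar F) (lowerStar F) (upperStar F)).inv ≫ wR (starCounit F) (upperStar F) =
      runitHom (upperStar F) ≫ (lunit (upperStar F)).inv := by
  simp only [← Category.assoc]
  rw [Iso.eq_comp_inv, lunit_hom]
  apply compMdl_hom_ext
  intro a b a'
  simp only [Mdl.comp_app, Category.assoc]
  rw [reassoc_of% (ι_wL (upperStar F) (starUnit F) a a' b)]
  have e0 := ι_assocInvApp (upperStar F) (lowerStar F) (upperStar F) a a' b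
  have e1 := congrArg ((F.obj a ⟶[V] F.obj a') ◁ ·) (ι_starCounit F (F.obj a') b a')
  simp only [MonoidalCategory.whiskerLeft_comp] at e1
  simp only [starUnit, comp_whiskerRight, Category.assoc]
  have e2 := congrArg (· ▷ (F.obj a' ⟶[V] b)) (e_comp_id V (F.obj a) (F.obj a'))
  simp only [comp_whiskerRight, MonoidalCategory.id_whiskerRight] at e2
  change _ ≫ _ ≫ _ ≫ _ ≫ _ ≫ assocInvApp (upperStar F) (lowerStar F) (upperStar F) a b ≫ _ = _
  rw [reassoc_of% e0, reassoc_of% (ι_assocApp₂ (upperStar F) (lowerStar F) (upperStar F)),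
    reassoc_of% (ι_wR (starCounit F) (upperStar F)), reassoc_of% e1, ι_runitHom, ι_lunitHom]
  have e3 := e_assoc' V (F.obj a) (F.obj a') (F.obj a') b
  dsimp
  rw [e3, reassoc_of% e2]

open Bicategory in
/-- The adjunction `F_* ⊣ F^*` in `V`-Mod. -/
noncomputable def starAdj :
    Bicategory.Adjunction (B := VMod.{w} V) (a := A) (b := B) (lowerStar F) (upperStar F) where
  unit := starUnit F
  counit := starCounit F
  left_triangle := by
    refine Eq.trans ?_ (star_left F)
    simp [leftZigzag, bicategoricalComp]
    rfl
  right_triangle := by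
    refine Eq.trans ?_ (star_right F)
    simp [rightZigzag, bicategoricalComp]
    rfl

end Adj

end Stars

section Collage

variable {V : Type u} [Category.{v} V] [MonoidalCategory V] [SymmetricCategory V]
  [MonoidalClosed V] [HasColimitsOfSize.{w, w} V]

theorem hasInitial_of_colimits (V : Type u) [Category.{v} V] [HasColimitsOfSize.{w, w} V] :
    HasInitial V :=
  haveI : HasFiniteColimits V := hasFiniteColimits_of_hasColimitsOfSize.{w, w} V
  inferInstance

/-- The initial object of `V`. -/
noncomputable def zeroObj (V : Type u) [Category.{v} V] [HasColimitsOfSize.{w, w} V] : V :=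
  haveI := hasInitial_of_colimits.{w} V
  ⊥_ V

/-- `zeroObj V` is initial. -/
noncomputable def botIsInitial (V : Type u) [Category.{v} V] [HasColimitsOfSize.{w, w} V] :
    IsInitial (zeroObj.{w} V) :=
  haveI := hasInitial_of_colimits.{w} V
  initialIsInitial

/-- The unique morphism `X ⊗ 0 ⟶ Y`. -/
noncomputable def fromTensorBot (X Y : V) : X ⊗ zeroObj.{w} V ⟶ Y :=
  MonoidalClosed.uncurry ((botIsInitial.{w} V).to _)

/-- The unique morphism `0 ⊗ X ⟶ Y`. -/
noncomputable def fromBotTensor (X Y : V) : zeroObj.{w} V ⊗ X ⟶ Y :=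
  (β_ _ _).hom ≫ fromTensorBot.{w} X Y

theorem bot_hom_ext {Y : V} (f g : zeroObj.{w} V ⟶ Y) : f = g :=
  (botIsInitial.{w} V).hom_ext f g

theorem tensor_hom_ext {X Z : V} (h : ∀ (Y : V) (f g : Z ⟶ Y), f = g) {Y : V}
    (f g : X ⊗ Z ⟶ Y) : f = g :=
  MonoidalClosed.curry_injective (h _ _ _)

theorem tensor_hom_ext' {X Z : V} (h : ∀ (Y : V) (f g : Z ⟶ Y), f = g) {Y : V}
    (f g : Z ⊗ X ⟶ Y) : f = g := by
  rw [← cancel_epi (β_ X Z).hom]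
  exact tensor_hom_ext h _ _

variable {A B : VMod.{w} V} (M : Mdl A B)

/-- Hom objects of the collage; `Sum.inl` is the inclusion `i₀` of `B`, `Sum.inr` is the
inclusion `i₁` of `A`. -/
noncomputable abbrev collageHom : B.carrier ⊕ A.carrier → B.carrier ⊕ A.carrier → V
  | .inl b, .inl b' => b ⟶[V] b'
  | .inl b, .inr a => M.obj b a
  | .inr _, .inl _ => zeroObj.{w} V
  | .inr a, .inr a' => a ⟶[V] a'

/-- Identities of the collage. -/
noncomputable abbrev collageId : ∀ x, 𝟙_ V ⟶ collageHom M x x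
  | .inl b => eId V b
  | .inr a => eId V a

/-- Composition of the collage: the compositions of `A` and `B` and their actions on `M`. -/
noncomputable abbrev collageComp :
    ∀ x y z, collageHom M x y ⊗ collageHom M y z ⟶ collageHom M x z
  | .inl b, .inl b', .inl b'' => eComp V b b' b''
  | .inl b, .inl b', .inr a => M.lact b b' a
  | .inl b, .inr a, .inr a' => M.ract b a a'
  | .inr a, .inr a', .inr a'' => eComp V a a' a''
  | .inl _, .inr _, .inl _ => fromTensorBot _ _
  | .inr _, .inr _, .inl _ => fromTensorBot _ _
  | .inr _, .inl _, .inl _ => fromBotTensor _ _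
  | .inr _, .inl _, .inr _ => fromBotTensor _ _

/-- The collage `C(M)` of a module `M : A ⟶ B`: the disjoint union of `A` and `B` as full
subcategories, with `C(M)(i₀ b, i₁ a) = M(b, a)` and `C(M)(i₁ a, i₀ b) = 0`. -/
noncomputable def collage : VMod.{w} V where
  carrier := B.carrier ⊕ A.carrier
  enr :=
    { Hom := collageHom M
      id := collageId M
      comp := collageComp M
      id_comp := by
        rintro (b | a) (b' | a')
        · exact e_id_comp V b b'
        · rw [Iso.inv_comp_eq]; simpa using M.id_lact b a'
        · exact bot_hom_ext _ _
        · exact e_id_comp V a a'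
      comp_id := by
        rintro (b | a) (b' | a')
        · exact e_comp_id V b b'
        · rw [Iso.inv_comp_eq]; simpa using M.ract_id b a'
        · exact bot_hom_ext _ _
        · exact e_comp_id V a a'
      assoc := by
        rintro (b₁ | a₁) (b₂ | a₂) (b₃ | a₃) (b₄ | a₄)
        · exact e_assoc V b₁ b₂ b₃ b₄
        · rw [Iso.inv_comp_eq]; exact M.comp_lact b₁ b₂ b₃ a₄
        · exact tensor_hom_ext (fun _ => tensor_hom_ext fun _ => bot_hom_ext) _ _
        · rw [Iso.inv_comp_eq]; exact M.lact_ract b₁ b₂ a₃ a₄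
        · exact tensor_hom_ext (fun _ => tensor_hom_ext' fun _ => bot_hom_ext) _ _
        · exact tensor_hom_ext (fun _ => tensor_hom_ext' fun _ => bot_hom_ext) _ _
        · exact tensor_hom_ext (fun _ => tensor_hom_ext fun _ => bot_hom_ext) _ _
        · exact (M.ract_comp b₁ a₂ a₃ a₄).symm
        · exact tensor_hom_ext' (fun _ => bot_hom_ext) _ _
        · exact tensor_hom_ext' (fun _ => bot_hom_ext) _ _
        · exact tensor_hom_ext' (fun _ => bot_hom_ext) _ _
        · exact tensor_hom_ext' (fun _ => bot_hom_ext) _ _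
        · exact tensor_hom_ext (fun _ => tensor_hom_ext' fun _ => bot_hom_ext) _ _
        · exact tensor_hom_ext (fun _ => tensor_hom_ext' fun _ => bot_hom_ext) _ _
        · exact tensor_hom_ext (fun _ => tensor_hom_ext fun _ => bot_hom_ext) _ _
        · exact e_assoc V a₁ a₂ a₃ a₄ }

/-- The inclusion `i₀ : B ⟶ C(M)`, which is the identity on homs. -/
noncomputable def collageI₀ : EnrichedFunctor V B.carrier (collage M).carrier where
  obj b := Sum.inl b
  map b b' := 𝟙 (b ⟶[V] b')
  map_id b := Category.comp_id _
  map_comp b b' b'' := by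
    have e : eComp V b b' b'' ≫ 𝟙 _ = (𝟙 _ ⊗ₘ 𝟙 _) ≫ eComp V b b' b'' := by
      rw [MonoidalCategory.id_tensorHom_id, Category.id_comp, Category.comp_id]
    exact e

/-- The inclusion `i₁ : A ⟶ C(M)`, which is the identity on homs. -/
noncomputable def collageI₁ : EnrichedFunctor V A.carrier (collage M).carrier where
  obj a := Sum.inr a
  map a a' := 𝟙 (a ⟶[V] a')
  map_id b := Category.comp_id _
  map_comp b b' b'' := by
    have e : eComp V b b' b'' ≫ 𝟙 _ = (𝟙 _ ⊗ₘ 𝟙 _) ≫ eComp V b b' b'' := by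
      rw [MonoidalCategory.id_tensorHom_id, Category.id_comp, Category.comp_id]
    exact e

/-- The morphism `C(M)(x, i₀ b) ⊗ M(b, a) ⟶ C(M)(x, i₁ a)` given by composition in `C(M)`, since
`M(b, a) = C(M)(i₀ b, i₁ a)`. -/
noncomputable def collageν (x : (collage M).carrier) (b : B.carrier) (a : A.carrier) :
    (x ⟶[V] (collageI₀ M).obj b) ⊗ M.obj b a ⟶ (x ⟶[V] (collageI₁ M).obj a) :=
  eComp V x ((collageI₀ M).obj b) ((collageI₁ M).obj a)

theorem collageν_dinat (x : (collage M).carrier) (a : A.carrier) (b b' : B.carrier) :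
    (x ⟶[V] (collageI₀ M).obj b) ◁ M.lact b b' a ≫ collageν M x b a =
      (α_ _ _ _).inv ≫ (lowerStar (collageI₀ M)).ract x b b' ▷ M.obj b' a ≫
        collageν M x b' a := by
  have e := e_assoc V (C := (collage M).carrier) x ((collageI₀ M).obj b) ((collageI₀ M).obj b')
    ((collageI₁ M).obj a)
  have e1 : (lowerStar (collageI₀ M)).ract x b b' =
      eComp V x ((collageI₀ M).obj b) ((collageI₀ M).obj b') := by
    change _ ◁ 𝟙 _ ≫ _ = _
    rw [MonoidalCategory.whiskerLeft_id]; exact Category.id_comp _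
  rw [e1]
  exact e.symm

theorem collageν_lact (x x' : (collage M).carrier) (b : B.carrier) (a : A.carrier) :
    (x ⟶[V] x') ◁ collageν M x' b a ≫ (lowerStar (collageI₁ M)).lact x x' a =
      (α_ _ _ _).inv ≫ (lowerStar (collageI₀ M)).lact x x' b ▷ M.obj b a ≫ collageν M x b a :=
  (e_assoc V (C := (collage M).carrier) x x' ((collageI₀ M).obj b) ((collageI₁ M).obj a)).symm

theorem collageν_ract (x : (collage M).carrier) (b : B.carrier) (a a' : A.carrier) :
    collageν M x b a ▷ (a ⟶[V] a') ≫ (lowerStar (collageI₁ M)).ract x a a' =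
      (α_ _ _ _).hom ≫ (x ⟶[V] (collageI₀ M).obj b) ◁ M.ract b a a' ≫ collageν M x b a' := by
  have e1 : (lowerStar (collageI₁ M)).ract x a a' =
      eComp V x ((collageI₁ M).obj a) ((collageI₁ M).obj a') := by
    change _ ◁ 𝟙 _ ≫ _ = _
    rw [MonoidalCategory.whiskerLeft_id]; exact Category.id_comp _
  rw [e1]
  exact (e_assoc' V (C := (collage M).carrier) x ((collageI₀ M).obj b) ((collageI₁ M).obj a)
    ((collageI₁ M).obj a')).symm

/-- The 2-cell `ν : i₀_* ∘ M ⟶ i₁_*` of the collage. -/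
noncomputable def collageCell :
    compMdl M (lowerStar (collageI₀ M)) ⟶ lowerStar (collageI₁ M) where
  app x a := compDesc (fun b => collageν M x b a) (collageν_dinat M x a)
  lact_app x x' a := by
    apply compObj_hom_ext_left
    intro b
    rw [← MonoidalCategory.whiskerLeft_comp_assoc, compι_desc, collageν_lact]
    dsimp only
    rw [reassoc_of% ι_compLact, compι_desc]
  ract_app x a a' := by
    apply compObj_hom_ext_right
    intro b
    rw [← comp_whiskerRight_assoc, compι_desc, collageν_ract]
    dsimp only
    rw [reassoc_of% ι_compRact, compι_desc]

end Collage

section Square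

open Bicategory

/-- In a bicategory, a square `λ : b ∘ p ⟶ j ∘ q` whose sides `q` and `b` have right adjoints `q'`
and `b'` is BC (exact) if its mate `p ∘ q' ⟶ b' ∘ j` is invertible. -/
def IsBC {𝓜 : Type*} [Bicategory 𝓜] {S A U B : 𝓜} {q : S ⟶ A} {q' : A ⟶ S} {b : U ⟶ B}
    {b' : B ⟶ U} (adjq : q ⊣ q') (adjb : b ⊣ b') {p : S ⟶ U} {j : A ⟶ B}
    (lam : p ≫ b ⟶ q ≫ j) : Prop :=
  IsIso (mateEquiv adjq adjb lam)

variable {V : Type u} [Category.{v} V] [MonoidalCategory V] [SymmetricCategory V]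
  [MonoidalClosed V] [HasColimitsOfSize.{w, w} V]

/-- The 1-morphism `F_*` of `V`-Mod. -/
noncomputable abbrev lower {A B : VMod.{w} V} (F : EnrichedFunctor V A.carrier B.carrier) :
    A ⟶ B := lowerStar F

/-- The 1-morphism `F^*` of `V`-Mod. -/
noncomputable abbrev upper {A B : VMod.{w} V} (F : EnrichedFunctor V A.carrier B.carrier) :
    B ⟶ A := upperStar F

/-- The 2-cell `ν : i₀_* ∘ M ⟶ i₁_*` of the collage, in `V`-Mod. -/
noncomputable abbrev ν {A B : VMod.{w} V} (M : A ⟶ B) :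
    M ≫ lower (collageI₀ M) ⟶ lower (collageI₁ M) := collageCell M

variable {S A U : VMod.{w} V} (Q : EnrichedFunctor V S.carrier A.carrier)
  (P : EnrichedFunctor V S.carrier U.carrier)

/-- The module `P_* ∘ Q^*` of a span. -/
noncomputable abbrev spanModule : A ⟶ U := upper Q ≫ lower P

/-- The 2-cell `λ : i₀_* ∘ P_* ⟶ i₁_* ∘ Q_*` of the cocomma square: the mate, under `Q_* ⊣ Q^*`,
of the collage 2-cell `ν : i₀_* ∘ (P_* ∘ Q^*) ⟶ i₁_*`. -/
noncomputable def cocommaCell :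
    lower P ≫ lower (collageI₀ (spanModule Q P)) ⟶ lower Q ≫ lower (collageI₁ (spanModule Q P)) :=
  (starAdj Q).homEquiv₁.symm ((Bicategory.associator _ _ _).inv ≫ ν (spanModule Q P))

end Square

end EnrichedModules

/-! The span enters only through the module `M = P_* ∘ Q^*`. The 2-cell λ is the transpose of the
collage cell ν under `Q_* ⊣ Q^*`, and forming the mate of λ transposes back across that same
adjunction. The triangle identities cancel the two transpositions, so the mate is the transpose of ν
under `i₀_* ⊣ i₀^*` alone, namely the composite `M ⟶ i₀^* ∘ i₀_* ∘ M ⟶ i₀^* ∘ i₁_*` of the unit with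
ν. This is formal and holds in every bicategory (`mateEquiv_homEquiv₁_symm`).

It remains to see that this composite is invertible for the collage of an arbitrary module `M`. For
a `V`-functor `F` and a cell `τ : F_* ∘ M ⟶ N`, the co-Yoneda lemma identifies `(F^* ∘ N)(b, a)`
with `N(F b, a)` (`isIso_upperStarCompInv`). Under this identification the transpose of τ is the map
`M(b, a) ⟶ N(F b, a)` that, read on elements, sends `m` to `τ(id ⊗ m)` (`homEquiv₂_starAdj_app`).
For `F = i₀` and `τ = ν`, the target is the collage hom from `i₀ b` to `i₁ a`, which is `M(b, a)`
itself, and ν is the action of `U` on `M`. The map is therefore `m ↦ id · m = m`, the identity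
(`isIso_collageCell_app_I₀`). Full faithfulness of `i₀` and the shape of the collage homs are thus
used only through these definitions. -/

namespace EnrichedModules

/-! ### Mates in an arbitrary bicategory -/

section Bicategory

open Bicategory

/-- If `σ` corresponds to `τ : (q' ≫ p) ≫ b ⟶ j` under `q ⊣ q'`, then the mate of `σ` under
`q ⊣ q'` and `b ⊣ b'` corresponds to `τ` under `b ⊣ b'`. -/
theorem mateEquiv_homEquiv₁_symm {𝓜 : Type*} [Bicategory 𝓜] {S A U B : 𝓜} {q : S ⟶ A}
    {q' : A ⟶ S} {b : U ⟶ B} {b' : B ⟶ U} (adjq : q ⊣ q') (adjb : b ⊣ b') {p : S ⟶ U} {j : A ⟶ B}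
    (τ : (q' ≫ p) ≫ b ⟶ j) :
    Bicategory.mateEquiv adjq adjb
        (adjq.homEquiv₁.symm ((Bicategory.associator _ _ _).inv ≫ τ)) = adjb.homEquiv₂ τ := by
  -- Both sides are transposed to 2-cells out of `p`, where only the units of the adjunctions occur
  -- and no counit is left to cancel.
  rw [Bicategory.mateEquiv_eq_iff, Adjunction.homEquiv₁_symm_apply, Adjunction.homEquiv₁_symm_apply,
    Adjunction.homEquiv₂_apply, Adjunction.homEquiv₂_apply]
  -- Up to coherence, one side applies the unit of `adjq` before that of `adjb` and the other side
  -- after it. They act on opposite ends of `p`, so the interchange law is the whole content.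
  have e := Bicategory.whisker_exchange adjq.unit (p ◁ adjb.unit)
  calc
    -- `bicategoricalComp` hides the structural isomorphisms, so that the two units stand next to
    -- each other exactly as on the right of `e`.
    _ = bicategoricalComp (𝟙 p) (bicategoricalComp
        (adjq.unit ▷ (p ≫ 𝟙 U) ≫ (q ≫ q') ◁ p ◁ adjb.unit) (q ◁ τ ▷ b')) := by
      bicategory
    _ = _ := by
      rw [← e]
      bicategory

end Bicategory

/-! ### Transposition under `F_* ⊣ F^*`, co-Yoneda, and the collage -/

section

variable {V : Type u} [Category.{v} V] [MonoidalCategory V]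

/-- Pointwise inverses commute with the actions automatically, which reduces invertibility in
`V`-Mod to invertibility in `V`. -/
theorem Mdl.isIso_of_app {A B : VMod.{w} V} {M N : Mdl A B} (f : M ⟶ N)
    (h : ∀ b a, IsIso (MdlHom.app f b a)) : IsIso f :=
  (Mdl.isoMk f (fun b a => inv (MdlHom.app f b a)) (by simp) (by simp)).isIso_hom

variable [SymmetricCategory V] [MonoidalClosed V] [HasColimitsOfSize.{w, w} V]
  {A B C : VMod.{w} V}

/-- The morphism `N(F b, a) ⟶ ∫^c C(F b, c) ⊗ N(c, a)` inserting the identity of `F b`. -/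
noncomputable def upperStarCompInv (F : EnrichedFunctor V B.carrier C.carrier) (N : Mdl A C)
    (b : B.carrier) (a : A.carrier) :
    N.obj (F.obj b) a ⟶ compObj N (upperStar F) b a :=
  (λ_ _).inv ≫ eId V (F.obj b) ▷ N.obj (F.obj b) a ≫ compι N (upperStar F) b a (F.obj b)

/-- The co-Yoneda lemma: `∫^c C(F b, c) ⊗ N(c, a)` is `N(F b, a)`. -/
theorem isIso_upperStarCompInv (F : EnrichedFunctor V B.carrier C.carrier) (N : Mdl A C)
    (b : B.carrier) (a : A.carrier) : IsIso (upperStarCompInv F N b a) := by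
  -- The coend diagram uses only the objects and the right action of `upperStar F`. At `b` these are
  -- literally those of the identity module of `C` at `F.obj b`, since `F.map` enters only the left
  -- action. Hence the coend is by definition the one in the right unitor of `N` at `F.obj b`, and
  -- `upperStarCompInv` is a component of the inverse unitor.
  have h₁ := congrArg (fun f => MdlHom.app f (F.obj b) a) (runit N).inv_hom_id
  have h₂ := congrArg (fun f => MdlHom.app f (F.obj b) a) (runit N).hom_inv_id
  exact ⟨MdlHom.app (runit N).hom (F.obj b) a, h₁, h₂⟩

/-- The unit of `F_* ⊣ F^*` takes the identity of `b` to two copies of the identity of `F b`. The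
inner copy meets `M` and is absorbed by `τ`, giving the map into `N(F b, a)`; the outer copy is the
one inserted by `upperStarCompInv`. This factorization isolates the part of the transpose that
depends on `τ`. -/
theorem homEquiv₂_starAdj_app (F : EnrichedFunctor V B.carrier C.carrier) (M : Mdl A B)
    (N : Mdl A C) (τ : compMdl M (lowerStar F) ⟶ N) (b : B.carrier) (a : A.carrier) :
    MdlHom.app ((starAdj F).homEquiv₂ (g := M) (h := N) τ) b a =
      ((λ_ _).inv ≫ eId V (F.obj b) ▷ M.obj b a ≫ compι M (lowerStar F) (F.obj b) a b ≫
        MdlHom.app τ (F.obj b) a) ≫ upperStarCompInv F N b a := by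
  -- The bicategorical operations are unfolded to those on modules, so that the rules for coend
  -- coprojections apply.
  have e : (starAdj F).homEquiv₂ (g := M) (h := N) τ = (runit M).inv ≫ wL M (starUnit F) ≫
    (assoc M (lowerStar F) (upperStar F)).inv ≫ wR τ (upperStar F) := rfl
  have e₁ : MdlHom.app (runit M).inv b a =
    (λ_ _).inv ≫ eId V b ▷ M.obj b a ≫ compι M (idMdl B) b a b := rfl
  have e₂ : MdlHom.app (assoc M (lowerStar F) (upperStar F)).inv b a =
    assocInvApp M (lowerStar F) (upperStar F) b a := rfl
  rw [e]
  simp only [Mdl.comp_app, e₁, e₂, Category.assoc]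
  -- The inverse unitor lands in the summand indexed by `b`, so each later map is evaluated on a
  -- coprojection.
  rw [reassoc_of% (ι_wL M (starUnit F) b b a),
    reassoc_of% (ι_assocInvApp M (lowerStar F) (upperStar F) b b a)]
  simp only [starUnit, comp_whiskerRight, Category.assoc]
  -- `starUnit` lands in the summand indexed by `F.obj b`. The identity of `b` inserted by the
  -- unitor becomes, by `F.map_id`, the outer identity of `F.obj b`.
  rw [reassoc_of% (ι_assocApp₂ M (lowerStar F) (upperStar F) b (F.obj b) b a),
    ι_wR τ (upperStar F) b (F.obj b) a, upperStarCompInv,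
    ← comp_whiskerRight_assoc (eId V b), F.map_id]
  have e₃ : (ρ_ (F.obj b ⟶[V] F.obj b)).inv ▷ M.obj b a ≫ (α_ _ _ _).hom =
    (F.obj b ⟶[V] F.obj b) ◁ (λ_ (M.obj b a)).inv := by simp
  rw [associator_naturality_middle_assoc, reassoc_of% e₃]
  simp only [← MonoidalCategory.whiskerLeft_comp_assoc, Category.assoc]
  -- The outer identity occupies a different tensor factor from everything done with `τ`, so its
  -- insertion can be postponed to the end.
  rw [← MonoidalCategory.whisker_exchange_assoc, ← leftUnitor_inv_naturality_assoc]
  simp only [Category.assoc]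

/-- Since the second factor in `homEquiv₂_starAdj_app` is the co-Yoneda isomorphism, only the
restriction of `τ` along `F`, evaluated at identities, has to be tested. No coend remains in the
source or target of the map to be inverted. -/
theorem isIso_homEquiv₂_starAdj (F : EnrichedFunctor V B.carrier C.carrier) (M : Mdl A B)
    (N : Mdl A C) (τ : compMdl M (lowerStar F) ⟶ N)
    (h : ∀ b a, IsIso ((λ_ _).inv ≫ eId V (F.obj b) ▷ M.obj b a ≫
      compι M (lowerStar F) (F.obj b) a b ≫ MdlHom.app τ (F.obj b) a)) :
    IsIso ((starAdj F).homEquiv₂ (g := M) (h := N) τ) := by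
  refine Mdl.isIso_of_app _ fun b a => ?_
  have := h b a
  have := isIso_upperStarCompInv F N b a
  rw [homEquiv₂_starAdj_app]
  infer_instance

/-- The restriction of the collage 2-cell along `i₀` is the identity of `M`. -/
theorem isIso_collageCell_app_I₀ (M : Mdl A B) (b : B.carrier) (a : A.carrier) :
    IsIso ((λ_ _).inv ≫ eId V ((collageI₀ M).obj b) ▷ M.obj b a ≫
      compι M (lowerStar (collageI₀ M)) ((collageI₀ M).obj b) a b ≫
        MdlHom.app (collageCell M) ((collageI₀ M).obj b) a) := by
  -- At an object `i₀ b` the cell is composition in the collage along `i₀ b`, `i₀ b`, `i₁ a`, and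
  -- this case of `collageComp` is the left action on `M`.
  have e₁ : compι M (lowerStar (collageI₀ M)) ((collageI₀ M).obj b) a b ≫
      MdlHom.app (collageCell M) ((collageI₀ M).obj b) a = M.lact b b a :=
    compι_desc _ (collageν_dinat M _ a) _
  have e₂ : (λ_ (M.obj b a)).inv ≫ eId V b ▷ M.obj b a ≫ M.lact b b a = 𝟙 (M.obj b a) := by
    rw [M.id_lact, Iso.inv_hom_id]
  -- The collage homs and identities agree with those of `M` and `B` by unfolding, so the equations
  -- are chained as terms and checked up to definitional equality.
  have e := (congrArg (fun t => (λ_ (M.obj b a)).inv ≫ eId V b ▷ M.obj b a ≫ t) e₁).trans e₂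
  have h : IsIso (𝟙 (M.obj b a)) := inferInstance
  rw [← e] at h
  exact h

end

end EnrichedModules

/-! ### Exactness of the cocomma square -/

theorem mainTheorem6 {V : Type u} [Category.{v} V] [MonoidalCategory V] [SymmetricCategory V]
    [MonoidalClosed V] [HasColimitsOfSize.{w, w} V] {S A U : EnrichedModules.VMod.{w} V}
    (Q : EnrichedFunctor V S.carrier A.carrier) (P : EnrichedFunctor V S.carrier U.carrier) :
    EnrichedModules.IsBC (EnrichedModules.starAdj Q)
      (EnrichedModules.starAdj (EnrichedModules.collageI₀ (EnrichedModules.spanModule Q P)))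
      (EnrichedModules.cocommaCell Q P) := by
  unfold EnrichedModules.IsBC EnrichedModules.cocommaCell
  -- The adjunction of `Q` disappears here; what is left concerns the collage of the single module
  -- `spanModule Q P`.
  rw [EnrichedModules.mateEquiv_homEquiv₁_symm]
  exact EnrichedModules.isIso_homEquiv₂_starAdj _ _ _ _
    (EnrichedModules.isIso_collageCell_app_I₀ (EnrichedModules.spanModule Q P))
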